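/- Let $n \ge 4$ and let $\mathcal T_n$ be the full transformation monoid, consisting of all maps $\{1,\dots,n\}\to\{1,\dots,n\}$ under composition. A (two-sided) congruence on $\mathcal T_n$ is an equivalence relation $\sigma$ on $\mathcal T_n$ such that $(\alpha,\beta),(\gamma,\delta)\in\sigma$ implies $(\alpha\gamma,\beta\delta)\in\sigma$; the congruences, ordered by inclusion, form a lattice $\mathsf{Cong}(\mathcal T_n)$. The height $\mathrm{Ht}(P)$ of a poset $P$ is the supremum of the cardinalities (numbers of elements) of chains in $P$. Then $$\mathrm{Ht}(\mathsf{Cong}(\mathcal T_n)) = 3n-1.$$ -/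

import Mathlib

/-- The full transformation monoid on an `n`-element set: all maps `Fin n → Fin n`, composed from
left to right (the product `α * β` applies `α` first), whence the opposite of `Function.End`. -/
abbrev FullTransformationMonoid (n : ℕ) : Type :=
  (Function.End (Fin n))ᵐᵒᵖ

/-- The height of a poset: the supremum of the cardinalities of its chains
(the number of elements of a chain, not the number of steps). -/
noncomputable def posetHeight (P : Type*) [PartialOrder P] : ℕ∞ :=
  (Set.univ : Set P).chainHeight (fun x y => x ≤ y)

/-!
The argument is Malcev's description of the congruences of the full transformation monoid.

Let `1 ≤ q ≤ n` and let `N` be a normal subgroup of the symmetric group on `q` points. Collapsing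
all maps of rank less than `q`, and identifying `i ∘ s` with `i ∘ π ∘ s` for `s` onto `Fin q`, `i`
an injection of `Fin q` and `π ∈ N`, gives a congruence `malcevCon n N`. These congruences are
pairwise distinct for `n ≥ 2`, and they are ordered lexicographically: first by `q`, then by
inclusion of `N`.

Conversely, every congruence other than the universal one has this form
(`eq_top_or_exists_eq_malcevCon`). Two facts carry this. If two related maps differ in kernel or
image, then everything up to the larger of their ranks is collapsed (`collapses_of_mapRel`): from a
pair of points identified by one map and separated by the other, every non-constant map of small
enough rank becomes related to a map of smaller rank, hence finally to a constant. If two distinct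
related maps have the same image, a restriction reduces to the first fact one rank lower
(`collapses_of_mapRel_of_range_eq`). Hence, with `q` the largest number such that all maps of rank
less than `q` are identified, the remaining identifications occur within rank `q`, between maps with
the same kernel and image; they are recorded by the normal subgroup `permSubgroup c q`.

The normal subgroups of the symmetric group on `q` points form a chain with `1, 2, 3, 4` members for
`q = 1, 2, 3, 4` and with `3` members for `q ≥ 5`. So the congruences form a chain, and with the
universal congruence there are `1 + 2 + 3 + 4 + 3 * (n - 4) + 1 = 3 * n - 1` of them.
-/

/-! ### Normal subgroups of the symmetric groups -/

section NormalSubgroups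

open Equiv.Perm

theorem eq_alternatingGroup_or_eq_top_of_le {α : Type*} [Fintype α] [DecidableEq α] [Nontrivial α]
    {N : Subgroup (Equiv.Perm α)} (h : alternatingGroup α ≤ N) :
    N = alternatingGroup α ∨ N = ⊤ := by
  have hd : N.index ∣ 2 := alternatingGroup.index_eq_two (α := α) ▸ Subgroup.index_dvd_of_le h
  rcases (Nat.dvd_prime Nat.prime_two).1 hd with h1 | h2
  · exact Or.inr (Subgroup.index_eq_one.1 h1)
  · exact Or.inl (eq_alternatingGroup_of_index_eq_two h2)

theorem alternatingGroup_ne_top {α : Type*} [Fintype α] [DecidableEq α] [Nontrivial α] :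
    alternatingGroup α ≠ ⊤ := by
  intro h
  have := alternatingGroup.index_eq_two (α := α)
  rw [h, Subgroup.index_top] at this
  omega

/-- A normal subgroup containing one three-cycle contains all of them, hence all even
permutations. -/
theorem alternatingGroup_le_of_isThreeCycle_mem {α : Type*} [Fintype α] [DecidableEq α]
    {N : Subgroup (Equiv.Perm α)} (hN : N.Normal) {x : Equiv.Perm α} (hx : x ∈ N)
    (h3 : x.IsThreeCycle) : alternatingGroup α ≤ N := by
  rw [← closure_three_cycles_eq_alternating, Subgroup.closure_le]
  intro y hy
  obtain ⟨a, rfl⟩ := isConj_iff.1 (isConj_iff_cycleType_eq.2 (h3.trans (Eq.symm hy)))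
  exact hN.conj_mem x hx a

theorem alternatingGroup_le_of_card_support_mul_conj {q : ℕ} {N : Subgroup (Equiv.Perm (Fin q))}
    (hN : N.Normal) {x : Equiv.Perm (Fin q)} (hx : x ∈ N)
    (h : ∃ a : Equiv.Perm (Fin q), (x * (a * x * a⁻¹)).support.card = 3) :
    alternatingGroup (Fin q) ≤ N := by
  obtain ⟨a, ha⟩ := h
  exact alternatingGroup_le_of_isThreeCycle_mem hN (N.mul_mem hx (hN.conj_mem x hx a))
    (card_support_eq_three_iff.1 ha)

/-- In degree three a nontrivial permutation times a suitable conjugate is a three-cycle, so its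
normal closure contains the alternating group. -/
theorem exists_card_support_mul_conj_three :
    ∀ x : Equiv.Perm (Fin 3), x ≠ 1 →
      ∃ a : Equiv.Perm (Fin 3), (x * (a * x * a⁻¹)).support.card = 3 := by
  decide

/-- The Klein four-group, as the subgroup of even involutions of four points together with the
identity. -/
def kleinFourPerm : Subgroup (Equiv.Perm (Fin 4)) where
  carrier := {x | x * x = 1 ∧ sign x = 1}
  one_mem' := by simp
  inv_mem' := by
    intro x hx
    refine ⟨?_, by simpa using hx.2⟩
    rw [← mul_inv_rev, hx.1, inv_one]
  mul_mem' := by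
    have : ∀ x y : Equiv.Perm (Fin 4), (x * x = 1 ∧ sign x = 1) → (y * y = 1 ∧ sign y = 1) →
        (x * y * (x * y) = 1 ∧ sign (x * y) = 1) := by decide +kernel
    exact fun {x y} => this x y

theorem mem_kleinFourPerm {x : Equiv.Perm (Fin 4)} :
    x ∈ kleinFourPerm ↔ x * x = 1 ∧ sign x = 1 := Iff.rfl

theorem kleinFourPerm_normal : kleinFourPerm.Normal := by
  refine ⟨fun x hx a => ⟨?_, by simp [hx.2]⟩⟩
  have : a * x * a⁻¹ * (a * x * a⁻¹) = a * (x * x) * a⁻¹ := by group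
  rw [this, hx.1]
  simp

/-- In degree four the same holds for permutations outside the Klein four-group. -/
theorem exists_card_support_mul_conj_four :
    ∀ x : Equiv.Perm (Fin 4), ¬ (x * x = 1 ∧ sign x = 1) →
      ∃ a : Equiv.Perm (Fin 4), (x * (a * x * a⁻¹)).support.card = 3 := by
  decide +kernel

theorem exists_conj_of_mem_kleinFourPerm :
    ∀ x y : Equiv.Perm (Fin 4), x ≠ 1 → (x * x = 1 ∧ sign x = 1) → y ≠ 1 →
      (y * y = 1 ∧ sign y = 1) → ∃ a : Equiv.Perm (Fin 4), a * x * a⁻¹ = y := by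
  decide +kernel

theorem kleinFourPerm_ne_bot : kleinFourPerm ≠ ⊥ := by
  intro h
  have : (c[0, 1] * c[2, 3] : Equiv.Perm (Fin 4)) ∈ kleinFourPerm :=
    mem_kleinFourPerm.2 (by decide)
  rw [h, Subgroup.mem_bot] at this
  exact absurd this (by decide)

theorem kleinFourPerm_lt_alternatingGroup : kleinFourPerm < alternatingGroup (Fin 4) := by
  refine lt_of_le_of_ne (fun x hx => mem_alternatingGroup.2 hx.2) fun h => ?_
  have : (c[0, 1, 2] : Equiv.Perm (Fin 4)) ∈ kleinFourPerm := by
    rw [h, mem_alternatingGroup]; decide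
  exact absurd this.1 (by decide)

theorem normal_subgroups_perm_one : {N : Subgroup (Equiv.Perm (Fin 1)) | N.Normal} = {⊥} := by
  ext N
  simp only [Set.mem_ofPred_eq, Set.mem_singleton_iff]
  exact ⟨fun _ => Subsingleton.elim _ _, fun h => h ▸ inferInstance⟩

theorem normal_subgroups_perm_two : {N : Subgroup (Equiv.Perm (Fin 2)) | N.Normal} = {⊥, ⊤} := by
  ext N
  simp only [Set.mem_ofPred_eq, Set.mem_singleton_iff, Set.mem_insert_iff]
  constructor
  · intro _
    have := eq_alternatingGroup_or_eq_top_of_le (N := N)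
      (by rw [alternatingGroup.eq_bot_of_card_le_two (by simp)]; exact bot_le)
    rwa [alternatingGroup.eq_bot_of_card_le_two (by simp)] at this
  · rintro (rfl | rfl) <;> infer_instance

theorem normal_subgroups_perm_four :
    {N : Subgroup (Equiv.Perm (Fin 4)) | N.Normal} =
      {⊥, kleinFourPerm, alternatingGroup (Fin 4), ⊤} := by
  ext N
  simp only [Set.mem_ofPred_eq, Set.mem_singleton_iff, Set.mem_insert_iff]
  constructor
  · intro hN
    by_cases hK : N ≤ kleinFourPerm
    · by_cases hb : N = ⊥
      · exact Or.inl hb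
      · refine Or.inr (Or.inl (le_antisymm hK fun y hy => ?_))
        obtain ⟨⟨x, hx⟩, hx1⟩ := Subgroup.ne_bot_iff_exists_ne_one.1 hb
        replace hx1 : x ≠ 1 := fun h => hx1 (Subtype.ext h)
        by_cases hy1 : y = 1
        · exact hy1 ▸ N.one_mem
        · obtain ⟨a, rfl⟩ := exists_conj_of_mem_kleinFourPerm x y hx1 (hK hx) hy1 hy
          exact hN.conj_mem _ hx a
    · obtain ⟨x, hx, hxK⟩ := SetLike.not_le_iff_exists.1 hK
      exact Or.inr (Or.inr (eq_alternatingGroup_or_eq_top_of_le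
        (alternatingGroup_le_of_card_support_mul_conj hN hx
          (exists_card_support_mul_conj_four x hxK))))
  · rintro (rfl | rfl | rfl | rfl)
    · infer_instance
    · exact kleinFourPerm_normal
    · infer_instance
    · infer_instance

theorem normal_subgroups_perm_of_ne_four {q : ℕ} (hq : 3 ≤ q) (hq4 : q ≠ 4) :
    {N : Subgroup (Equiv.Perm (Fin q)) | N.Normal} = {⊥, alternatingGroup (Fin q), ⊤} := by
  have : Nontrivial (Fin q) := Fin.nontrivial_iff_two_le.2 (by omega)
  ext N
  simp only [Set.mem_ofPred_eq, Set.mem_singleton_iff, Set.mem_insert_iff]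
  constructor
  · intro hN
    by_cases hb : N = ⊥
    · exact Or.inl hb
    · refine Or.inr (eq_alternatingGroup_or_eq_top_of_le ?_)
      by_cases h5 : 5 ≤ q
      · exact alternatingGroup_le_of_normal (by simpa using h5)
          ((Subgroup.nontrivial_iff_ne_bot N).2 hb)
      · obtain rfl : q = 3 := by omega
        obtain ⟨x, hx⟩ := Subgroup.ne_bot_iff_exists_ne_one.1 hb
        exact alternatingGroup_le_of_card_support_mul_conj hN x.2
          (exists_card_support_mul_conj_three x fun h => hx (Subtype.ext h))
  · rintro (rfl | rfl | rfl) <;> infer_instance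

theorem alternatingGroup_ne_bot {q : ℕ} (hq : 3 ≤ q) : alternatingGroup (Fin q) ≠ ⊥ := by
  have := alternatingGroup.nontrivial_of_three_le_card (α := Fin q) (by simpa using hq)
  exact (Subgroup.nontrivial_iff_ne_bot _).1 this

theorem isChain_normal_subgroups_perm {q : ℕ} (hq : 1 ≤ q) :
    IsChain (· ≤ ·) {N : Subgroup (Equiv.Perm (Fin q)) | N.Normal} := by
  have hK := kleinFourPerm_lt_alternatingGroup.le
  intro N hN M hM _
  obtain rfl | rfl | rfl | ⟨h3, h4⟩ : q = 1 ∨ q = 2 ∨ q = 4 ∨ 3 ≤ q ∧ q ≠ 4 := by omega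
  · rw [normal_subgroups_perm_one] at hN hM
    exact Or.inl (hN.trans hM.symm).le
  · rw [normal_subgroups_perm_two] at hN hM
    rcases hN with rfl | rfl <;> simp
  · rw [normal_subgroups_perm_four] at hN hM
    rcases hN with rfl | rfl | rfl | rfl <;> rcases hM with rfl | rfl | rfl | rfl <;> simp [hK]
  · rw [normal_subgroups_perm_of_ne_four h3 h4] at hN hM
    rcases hN with rfl | rfl | rfl <;> rcases hM with rfl | rfl | rfl <;> simp

theorem ncard_normal_subgroups_perm_one :
    {N : Subgroup (Equiv.Perm (Fin 1)) | N.Normal}.ncard = 1 := by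
  rw [normal_subgroups_perm_one, Set.ncard_singleton]

theorem ncard_normal_subgroups_perm_two :
    {N : Subgroup (Equiv.Perm (Fin 2)) | N.Normal}.ncard = 2 := by
  rw [normal_subgroups_perm_two, Set.ncard_pair bot_ne_top]

theorem ncard_normal_subgroups_perm_four :
    {N : Subgroup (Equiv.Perm (Fin 4)) | N.Normal}.ncard = 4 := by
  have h1 := kleinFourPerm_ne_bot.symm
  have h2 := kleinFourPerm_lt_alternatingGroup.ne
  have h3 := (alternatingGroup_ne_bot (q := 4) (by norm_num)).symm
  have h4 := alternatingGroup_ne_top (α := Fin 4)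
  have h5 := (kleinFourPerm_lt_alternatingGroup.trans_le le_top).ne
  rw [normal_subgroups_perm_four, Set.ncard_insert_of_notMem (by simp [h1, h3]),
    Set.ncard_insert_of_notMem (by simp [h2, h5]), Set.ncard_pair h4]

theorem ncard_normal_subgroups_perm_of_ne_four {q : ℕ} (hq : 3 ≤ q) (hq4 : q ≠ 4) :
    {N : Subgroup (Equiv.Perm (Fin q)) | N.Normal}.ncard = 3 := by
  have : Nontrivial (Fin q) := Fin.nontrivial_iff_two_le.2 (by omega)
  have h3 := (alternatingGroup_ne_bot hq).symm
  rw [normal_subgroups_perm_of_ne_four hq hq4, Set.ncard_insert_of_notMem (by simp [h3]),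
    Set.ncard_pair alternatingGroup_ne_top]

end NormalSubgroups

/-! ### Ranks of transformations -/

section Rank

variable {n : ℕ}

/-- The rank of a transformation: the number of elements of its image. -/
def transRank (f : Fin n → Fin n) : ℕ :=
  (Finset.univ.image f).card

theorem transRank_comp_le_right (k f : Fin n → Fin n) : transRank (k ∘ f) ≤ transRank f := by
  rw [transRank, ← Finset.image_image]
  exact Finset.card_image_le

theorem transRank_comp_le_left (f k : Fin n → Fin n) : transRank (f ∘ k) ≤ transRank f := by
  refine Finset.card_le_card fun y hy => ?_
  obtain ⟨x, -, rfl⟩ := Finset.mem_image.1 hy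
  exact Finset.mem_image_of_mem f (Finset.mem_univ _)

theorem transRank_le (f : Fin n → Fin n) : transRank f ≤ n :=
  Finset.card_image_le.trans (by simp)

theorem transRank_pos (f : Fin n → Fin n) (x : Fin n) : 0 < transRank f :=
  Finset.card_pos.2 ⟨f x, Finset.mem_image_of_mem f (Finset.mem_univ _)⟩

/-- Collapsing two points of the image strictly lowers the rank. -/
theorem transRank_comp_lt {k f : Fin n → Fin n} {x y : Fin n} (hf : f x ≠ f y)
    (hk : k (f x) = k (f y)) : transRank (k ∘ f) < transRank f := by
  refine lt_of_le_of_ne (transRank_comp_le_right k f) fun h => hf ?_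
  rw [transRank, ← Finset.image_image] at h
  exact Finset.card_image_iff.1 h (by simp) (by simp) hk

theorem exists_ne_of_two_le_transRank {f : Fin n → Fin n} (h : 2 ≤ transRank f) :
    ∃ x y, f x ≠ f y := by
  obtain ⟨a, ha, b, hb, hab⟩ := Finset.one_lt_card.1 h
  obtain ⟨x, -, rfl⟩ := Finset.mem_image.1 ha
  obtain ⟨y, -, rfl⟩ := Finset.mem_image.1 hb
  exact ⟨x, y, hab⟩

theorem eq_const_of_transRank_le_one {f : Fin n → Fin n} (h : transRank f ≤ 1) (x : Fin n) :
    f = fun _ => f x := by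
  funext y
  exact Finset.card_le_one.1 h _ (by simp) _ (by simp)

/-- If the kernel of `f` is contained in that of `g`, then `g` has at most the rank of `f`. -/
theorem transRank_le_of_ker_le {f g : Fin n → Fin n} (h : ∀ x y, f x = f y → g x = g y) :
    transRank g ≤ transRank f := by
  obtain ⟨k, hk⟩ : ∃ k : Fin n → Fin n, g = k ∘ f := by
    rcases isEmpty_or_nonempty (Fin n) with hn | hn
    · exact ⟨id, Subsingleton.elim _ _⟩
    · refine ⟨fun p => g (Function.invFun f p), funext fun x => h _ _ ?_⟩
      exact (Function.invFun_eq ⟨x, rfl⟩).symm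
  exact hk ▸ transRank_comp_le_right k f

/-- If the kernel of `f` is contained in that of `g`, and `f` has at most the rank of `g`, then the
two kernels agree. -/
theorem ker_eq_of_ker_le {f g : Fin n → Fin n} (h : ∀ x y, f x = f y → g x = g y)
    (hr : transRank f ≤ transRank g) (x y : Fin n) : f x = f y ↔ g x = g y := by
  refine ⟨h x y, fun hg => ?_⟩
  by_contra hf
  have hn : Nonempty (Fin n) := ⟨x⟩
  have hk : g = (g ∘ Function.invFun f) ∘ f :=
    funext fun z => h _ _ (Function.invFun_eq ⟨z, rfl⟩).symm
  have := transRank_comp_lt (k := g ∘ Function.invFun f) hf (by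
    have h1 := congrFun hk x
    have h2 := congrFun hk y
    simp only [Function.comp_apply] at h1 h2 ⊢
    rw [← h1, ← h2, hg])
  rw [← hk] at this
  omega

/-- A transformation `t` of rank at most that of `g` factors as `a ∘ g ∘ j ∘ t`, where `j` carries
two prescribed points of the image of `t` to two prescribed points that `g` separates. -/
theorem exists_factorization {t g : Fin n → Fin n} (hr : transRank t ≤ transRank g)
    {x y u v : Fin n} (hg : g x ≠ g y) (ht : t u ≠ t v) :
    ∃ a j : Fin n → Fin n, a ∘ g ∘ j ∘ t = t ∧ j (t u) = x ∧ j (t v) = y := by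
  have htr : 2 ≤ transRank t := Finset.one_lt_card.2 ⟨t u, by simp, t v, by simp, ht⟩
  obtain ⟨S, hS1, hS2, hS3⟩ := Finset.exists_subsuperset_card_eq
    (s := {g x, g y}) (t := Finset.univ.image g)
    (by intro z hz; simp only [Finset.mem_insert, Finset.mem_singleton] at hz
        rcases hz with rfl | rfl <;> simp)
    ((Finset.card_pair hg).trans_le htr) hr
  obtain ⟨e, he⟩ := Finset.exists_equiv_extend_of_card_eq
    (α := (Finset.univ.image t : Finset (Fin n))) (t := S)
    (by rw [hS3, Fintype.card_coe, transRank])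
    (s := {⟨t u, by simp⟩, ⟨t v, by simp⟩})
    (f := fun i => if (i : Fin n) = t u then g x else g y)
    (by
      intro z hz
      obtain ⟨i, -, rfl⟩ := Finset.mem_image.1 hz
      split_ifs <;> exact hS1 (by simp))
    (by
      intro i hi i' hi' h
      simp only [Finset.coe_insert, Finset.coe_singleton, Set.mem_insert_iff,
        Set.mem_singleton_iff] at hi hi'
      rcases hi with rfl | rfl <;> rcases hi' with rfl | rfl <;>
        simp_all [Ne.symm ht, Ne.symm hg])
  have hsec : ∀ p : (Finset.univ.image t : Finset (Fin n)), ∃ z, g z = e p := fun p => by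
    simpa using hS2 (e p).2
  choose s hs using hsec
  have hn : Nonempty (Fin n) := ⟨x⟩
  let j : Fin n → Fin n := fun p => if p = t u then x else if p = t v then y else
    if h : p ∈ Finset.univ.image t then s ⟨p, h⟩ else x
  have hj : ∀ z, g (j (t z)) = e ⟨t z, by simp⟩ := by
    intro z
    by_cases h1 : t z = t u
    · have := he ⟨t u, by simp⟩ (by simp)
      simp only [if_true] at this
      simp [j, h1, this]
    by_cases h2 : t z = t v
    · have := he ⟨t v, by simp⟩ (by simp)
      simp only [Ne.symm ht, if_false] at this
      simp [j, h2, this, Ne.symm ht]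
    · simp [j, h1, h2, hs]
  refine ⟨Function.invFunOn (g ∘ j) (Set.range t), j, ?_, by simp [j], by simp [j, Ne.symm ht]⟩
  have hinj : Set.InjOn (g ∘ j) (Set.range t) := by
    rintro _ ⟨z, rfl⟩ _ ⟨w, rfl⟩ h
    simp only [Function.comp_apply, hj] at h
    simpa using e.injective (Subtype.ext h)
  funext z
  exact hinj.leftInvOn_invFunOn ⟨z, rfl⟩

end Rank

/-! ### Congruences and collapsed ideals -/

section Collapse

open MulOpposite

variable {n : ℕ}

/-- A congruence read as a relation between maps. -/
def MapRel (c : Con (FullTransformationMonoid n)) (f g : Fin n → Fin n) : Prop :=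
  c (op f) (op g)

variable {c : Con (FullTransformationMonoid n)} {f g h : Fin n → Fin n}

theorem MapRel.refl (f : Fin n → Fin n) : MapRel c f f := c.refl _

theorem MapRel.symm (h : MapRel c f g) : MapRel c g f := Con.symm c h

theorem MapRel.trans (h₁ : MapRel c f g) (h₂ : MapRel c g h) : MapRel c f h := Con.trans c h₁ h₂

theorem MapRel.comp_left (k : Fin n → Fin n) (h : MapRel c f g) : MapRel c (k ∘ f) (k ∘ g) :=
  Con.mul c h (c.refl (op k))

theorem MapRel.comp_right (k : Fin n → Fin n) (h : MapRel c f g) : MapRel c (f ∘ k) (g ∘ k) :=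
  Con.mul c (c.refl (op k)) h

/-- A congruence collapses rank `q` if it identifies all transformations of rank less than `q`. -/
def Collapses (c : Con (FullTransformationMonoid n)) (q : ℕ) : Prop :=
  ∀ f g : Fin n → Fin n, transRank f < q → transRank g < q → MapRel c f g

theorem mapRel_const_of_ne {a b : Fin n} (hab : a ≠ b)
    (h : MapRel c (fun _ => a) (fun _ => b)) (u v : Fin n) :
    MapRel c (fun _ => u) (fun _ => v) := by
  have := h.comp_left (fun p => if p = a then u else v)
  simpa [Function.comp_def, Ne.symm hab] using this

/-- If `f` and `g` are related and `g` separates two points that `f` identifies, then every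
non-constant map of rank at most that of `g` is related to one of smaller rank. -/
theorem exists_mapRel_transRank_lt (hc : MapRel c f g) {x y : Fin n} (hf : f x = f y)
    (hg : g x ≠ g y) {t : Fin n → Fin n} (hr : transRank t ≤ transRank g) (h2 : 2 ≤ transRank t) :
    ∃ t', transRank t' < transRank t ∧ MapRel c t t' := by
  obtain ⟨u, v, huv⟩ := exists_ne_of_two_le_transRank h2
  obtain ⟨a, j, hj, hu, hv⟩ := exists_factorization hr hg huv
  refine ⟨(a ∘ f ∘ j) ∘ t, transRank_comp_lt huv (by simp [hu, hv, hf]), ?_⟩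
  have := ((hc.comp_left a).comp_right (j ∘ t)).symm
  have hj' : (a ∘ g) ∘ j ∘ t = t := hj
  rw [hj'] at this
  exact this

theorem collapses_of_ker_not_le (hc : MapRel c f g) {x y : Fin n} (hf : f x = f y)
    (hg : g x ≠ g y) : Collapses c (transRank g + 1) := by
  have hconst : ∀ t : Fin n → Fin n, transRank t ≤ transRank g →
      ∃ u, MapRel c t (fun _ => u) := by
    intro t
    induction hm : transRank t using Nat.strong_induction_on generalizing t with
    | _ m ih =>
      intro hr
      rcases Nat.lt_or_ge m 2 with h1 | h2
      · refine ⟨t x, ?_⟩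
        rw [← eq_const_of_transRank_le_one (f := t) (by omega) x]
        exact MapRel.refl t
      · obtain ⟨t', ht', hrel⟩ := exists_mapRel_transRank_lt hc hf hg (hm ▸ hr) (hm ▸ h2)
        obtain ⟨u, hu⟩ := ih _ (hm ▸ ht') t' rfl (by omega)
        exact ⟨u, hrel.trans hu⟩
  have hcc : ∀ u v : Fin n, MapRel c (fun _ => u) (fun _ => v) := by
    refine mapRel_const_of_ne hg ?_
    have h1 : MapRel c (fun _ => f x) (fun _ => g x) := hc.comp_right fun _ => x
    have h2 : MapRel c (fun _ => f y) (fun _ => g y) := hc.comp_right fun _ => y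
    rw [hf] at h1
    exact h1.symm.trans h2
  intro t t' ht ht'
  obtain ⟨u, hu⟩ := hconst t (by omega)
  obtain ⟨v, hv⟩ := hconst t' (by omega)
  exact (hu.trans (hcc u v)).trans hv.symm

/-- Related maps with different kernels or different images collapse everything up to the larger of
their ranks. -/
theorem collapses_of_mapRel_of_transRank_le (hc : MapRel c f g) (hr : transRank f ≤ transRank g)
    (h : ¬ ((∀ x y, f x = f y ↔ g x = g y) ∧ Set.range f = Set.range g)) :
    Collapses c (transRank g + 1) := by
  by_cases hker : ∀ x y, f x = f y → g x = g y
  swap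
  · push Not at hker
    obtain ⟨x, y, hf, hg⟩ := hker
    exact collapses_of_ker_not_le hc hf hg
  have hiff := ker_eq_of_ker_le hker hr
  -- The images have the same size, so `f` takes a value `f x` that `g` misses.
  have hcard : transRank f = transRank g := le_antisymm hr (transRank_le_of_ker_le hker)
  obtain ⟨x, hx⟩ : ∃ x, f x ∉ Set.range g := by
    by_contra! hcon
    refine h ⟨hiff, ?_⟩
    have : Finset.univ.image f = Finset.univ.image g :=
      Finset.eq_of_subset_of_card_le (fun z hz => by
        obtain ⟨w, -, rfl⟩ := Finset.mem_image.1 hz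
        simpa using hcon w) hcard.ge
    simpa using congrArg (fun s : Finset (Fin n) => (s : Set (Fin n))) this
  rcases Nat.lt_or_ge (transRank g) 2 with h1 | h2
  · have hf := eq_const_of_transRank_le_one (f := f) (by omega) x
    have hg := eq_const_of_transRank_le_one (f := g) (by omega) x
    have hcc := mapRel_const_of_ne (c := c) (a := f x) (b := g x) (fun e => hx ⟨x, e.symm⟩)
      (by rw [← hf, ← hg]; exact hc)
    intro t t' ht ht'
    have h2 := hcc (t x) (t' x)
    rwa [← eq_const_of_transRank_le_one (by omega) x,
      ← eq_const_of_transRank_le_one (by omega) x] at h2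
  · -- Sending `f x` to another value `f y` of `f` and fixing all else leaves `g` unchanged.
    obtain ⟨y, hy⟩ : ∃ y, f y ≠ f x := by
      by_contra! hcon
      obtain ⟨a, b, hab⟩ := exists_ne_of_two_le_transRank (hcard ▸ h2)
      exact hab ((hcon a).trans (hcon b).symm)
    let k : Fin n → Fin n := fun p => if p = f x then f y else p
    have hkg : k ∘ g = g := by
      funext z
      have : g z ≠ f x := fun e => hx ⟨z, e⟩
      simp [k, this]
    have hk := hc.comp_left k
    rw [hkg] at hk
    exact collapses_of_ker_not_le hk (x := x) (y := y) (by simp [k, hy])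
      fun e => hy ((hiff x y).2 e).symm

theorem collapses_of_mapRel (hc : MapRel c f g)
    (h : ¬ ((∀ x y, f x = f y ↔ g x = g y) ∧ Set.range f = Set.range g)) :
    Collapses c (max (transRank f) (transRank g) + 1) := by
  rcases le_total (transRank f) (transRank g) with hr | hr
  · rw [max_eq_right hr]
    exact collapses_of_mapRel_of_transRank_le hc hr h
  · rw [max_eq_left hr]
    refine collapses_of_mapRel_of_transRank_le hc.symm hr fun h' => h ?_
    exact ⟨fun x y => (h'.1 x y).symm, h'.2.symm⟩

/-- Two distinct related maps with the same image collapse everything of smaller rank: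
after removing one point of the image of `f` by restriction, the images differ. -/
theorem collapses_of_mapRel_of_range_eq (hc : MapRel c f g) (hne : f ≠ g)
    (him : Set.range f = Set.range g) : Collapses c (transRank f) := by
  obtain ⟨x, hx⟩ := Function.ne_iff.1 hne
  obtain ⟨y, hy⟩ : g x ∈ Set.range f := him ▸ ⟨x, rfl⟩
  let e : Fin n → Fin n := fun z => if f z = g x then x else z
  have hfe : ∀ z, f (e z) ≠ g x := by
    intro z
    by_cases hz : f z = g x
    · simp [e, hz, hx]
    · simp [e, hz]
  have hex : e x = x := by simp [e]
  have hrank : transRank f ≤ transRank (f ∘ e) + 1 := by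
    have hsub : Finset.univ.image f ⊆ insert (g x) (Finset.univ.image (f ∘ e)) := by
      intro w hw
      obtain ⟨z, -, rfl⟩ := Finset.mem_image.1 hw
      by_cases hz : f z = g x
      · simp [hz]
      · exact Finset.mem_insert_of_mem (Finset.mem_image.2 ⟨z, by simp, by simp [e, hz]⟩)
    exact (Finset.card_le_card hsub).trans (Finset.card_insert_le _ _)
  have hcol := collapses_of_mapRel (hc.comp_right e) (by
    rintro ⟨-, hr⟩
    obtain ⟨z, hz⟩ : g x ∈ Set.range (f ∘ e) := hr ▸ ⟨x, by simp [hex]⟩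
    exact hfe z hz)
  intro t t' ht ht'
  have := le_max_left (transRank (f ∘ e)) (transRank (g ∘ e))
  exact hcol t t' (by omega) (by omega)

end Collapse

/-! ### The congruences attached to normal subgroups -/

section Malcev

open MulOpposite

variable {n q : ℕ}

theorem transRank_comp_eq {s : Fin n → Fin q} {i : Fin q → Fin n} (hs : Function.Surjective s)
    (hi : Function.Injective i) : transRank (i ∘ s) = q := by
  rw [transRank, ← Finset.image_image, Finset.image_univ_of_surjective hs,
    Finset.card_image_of_injective _ hi, Finset.card_univ, Fintype.card_fin]

theorem transRank_comp_lt_of_not_injective (s : Fin n → Fin q) {i : Fin q → Fin n}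
    (hi : ¬ Function.Injective i) : transRank (i ∘ s) < q := by
  rw [transRank, ← Finset.image_image]
  refine (Finset.card_le_card (Finset.image_subset_image (Finset.subset_univ _))).trans_lt ?_
  refine lt_of_le_of_ne (Finset.card_image_le.trans (by simp)) fun h => hi ?_
  simpa using Finset.card_image_iff.1 (h.trans (Finset.card_fin q).symm)

theorem transRank_comp_lt_of_not_surjective {s : Fin n → Fin q} (i : Fin q → Fin n)
    (hs : ¬ Function.Surjective s) : transRank (i ∘ s) < q := by
  rw [transRank, ← Finset.image_image]
  refine Finset.card_image_le.trans_lt ?_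
  refine lt_of_le_of_ne ((Finset.card_le_univ _).trans (by simp)) fun h => hs ?_
  have h' : (Finset.univ.image s).card = Fintype.card (Fin q) := by simpa using h
  have := (Finset.card_eq_iff_eq_univ _).1 h'
  intro y
  have hy : y ∈ Finset.univ.image s := this ▸ Finset.mem_univ y
  simpa using hy

theorem exists_eq_comp_of_transRank_eq {f : Fin n → Fin n} (hf : transRank f = q) :
    ∃ (s : Fin n → Fin q) (i : Fin q → Fin n),
      Function.Surjective s ∧ Function.Injective i ∧ f = i ∘ s := by
  let e := (Finset.univ.image f).equivFinOfCardEq hf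
  refine ⟨fun x => e ⟨f x, by simp⟩, fun p => e.symm p, fun p => ?_, ?_, ?_⟩
  · obtain ⟨x, -, hx⟩ := Finset.mem_image.1 (e.symm p).2
    exact ⟨x, by simp [hx]⟩
  · exact Subtype.val_injective.comp e.symm.injective
  · funext x
    simp

theorem exists_perm_of_comp_eq_comp {s s' : Fin n → Fin q} {i i' : Fin q → Fin n}
    (hs' : Function.Surjective s') (hi : Function.Injective i) (hi' : Function.Injective i')
    (h : i ∘ s = i' ∘ s') : ∃ τ : Equiv.Perm (Fin q), i' = i ∘ τ ∧ s = τ ∘ s' := by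
  have hiσ : ∀ p, i (s (Function.surjInv hs' p)) = i' p := fun p => by
    rw [show i (s (Function.surjInv hs' p)) = i' (s' (Function.surjInv hs' p)) from congrFun h _,
      Function.surjInv_eq hs']
  have hinj : Function.Injective fun p => s (Function.surjInv hs' p) := fun p p' hp =>
    hi' (by rw [← hiσ, ← hiσ]; exact congrArg i hp)
  refine ⟨Equiv.ofBijective _ (Finite.injective_iff_bijective.1 hinj), ?_, ?_⟩
  · funext p
    exact (hiσ p).symm
  · funext x
    apply hi
    simp only [Function.comp_apply, Equiv.ofBijective_apply, hiσ]
    exact congrFun h x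

/-- Two transformations of rank `q` with the same kernel and the same image differ by a permutation
of `q` points. -/
theorem exists_perm_of_ker_eq_of_range_eq {s : Fin n → Fin q} {i : Fin q → Fin n}
    (hs : Function.Surjective s) (hi : Function.Injective i) {g : Fin n → Fin n}
    (hker : ∀ x y, (i ∘ s) x = (i ∘ s) y ↔ g x = g y) (him : Set.range (i ∘ s) = Set.range g) :
    ∃ π : Equiv.Perm (Fin q), g = i ∘ π ∘ s := by
  have hex : ∀ x, ∃ p, i p = g x := fun x => by
    obtain ⟨y, hy⟩ : g x ∈ Set.range (i ∘ s) := him ▸ ⟨x, rfl⟩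
    exact ⟨s y, hy⟩
  choose s' hs' using hex
  have hsurj : Function.Surjective s' := fun p => by
    obtain ⟨y, rfl⟩ := hs p
    obtain ⟨x, hx⟩ : (i ∘ s) y ∈ Set.range g := him ▸ ⟨y, rfl⟩
    exact ⟨x, hi ((hs' x).trans hx)⟩
  have hfac : ∀ x, s' (Function.surjInv hs (s x)) = s' x := fun x => hi (by
    rw [hs', hs', ← hker]
    simp [Function.surjInv_eq])
  have hsurj' : Function.Surjective fun p => s' (Function.surjInv hs p) := fun p => by
    obtain ⟨x, rfl⟩ := hsurj p
    exact ⟨s x, hfac x⟩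
  refine ⟨Equiv.ofBijective _ (Finite.surjective_iff_bijective.1 hsurj'), ?_⟩
  funext x
  simp [hfac, hs']

/-- The relation that collapses all transformations of rank less than `q` and identifies two
transformations of rank `q` when they share image and kernel and differ by an element of `N`. Image
and kernel are presented by a factorization through `Fin q`; the choice of factorization is
immaterial when `N` is normal. -/
def MalcevRel (n : ℕ) {q : ℕ} (N : Subgroup (Equiv.Perm (Fin q))) (f g : Fin n → Fin n) : Prop :=
  f = g ∨ (transRank f < q ∧ transRank g < q) ∨
    ∃ (s : Fin n → Fin q) (i : Fin q → Fin n) (π : Equiv.Perm (Fin q)),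
      Function.Surjective s ∧ Function.Injective i ∧ π ∈ N ∧ f = i ∘ s ∧ g = i ∘ π ∘ s

variable {N : Subgroup (Equiv.Perm (Fin q))} {f g h : Fin n → Fin n}

theorem MalcevRel.symm (hfg : MalcevRel n N f g) : MalcevRel n N g f := by
  rcases hfg with rfl | ⟨h1, h2⟩ | ⟨s, i, π, hs, hi, hπ, rfl, rfl⟩
  · exact Or.inl rfl
  · exact Or.inr (Or.inl ⟨h2, h1⟩)
  · refine Or.inr (Or.inr ⟨π ∘ s, i, π⁻¹, π.surjective.comp hs, hi, N.inv_mem hπ, rfl, ?_⟩)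
    funext x
    simp

theorem MalcevRel.trans (hN : N.Normal) (hfg : MalcevRel n N f g) (hgh : MalcevRel n N g h) :
    MalcevRel n N f h := by
  rcases hfg with rfl | ⟨h1, h2⟩ | ⟨s, i, π, hs, hi, hπ, rfl, rfl⟩
  · exact hgh
  · rcases hgh with rfl | ⟨h3, h4⟩ | ⟨s', i', π', hs', hi', -, rfl, -⟩
    · exact Or.inr (Or.inl ⟨h1, h2⟩)
    · exact Or.inr (Or.inl ⟨h1, h4⟩)
    · rw [transRank_comp_eq hs' hi'] at h2
      exact absurd h2 (lt_irrefl q)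
  · rcases hgh with rfl | ⟨h3, -⟩ | ⟨s', i', π', hs', hi', hπ', heq, rfl⟩
    · exact Or.inr (Or.inr ⟨s, i, π, hs, hi, hπ, rfl, rfl⟩)
    · rw [transRank_comp_eq (π.surjective.comp hs) hi] at h3
      exact absurd h3 (lt_irrefl q)
    · -- The two factorizations of the middle map differ by a permutation `τ`.
      obtain ⟨τ, rfl, hτ⟩ := exists_perm_of_comp_eq_comp hs' hi hi' heq
      refine Or.inr (Or.inr ⟨s, i, τ * π' * τ⁻¹ * π, hs, hi,
        N.mul_mem (hN.conj_mem _ hπ' _) hπ, rfl, ?_⟩)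
      funext x
      have := congrFun hτ x
      simp only [Function.comp_apply] at this
      simp [this]

theorem MalcevRel.comp_left (k : Fin n → Fin n) (hfg : MalcevRel n N f g) :
    MalcevRel n N (k ∘ f) (k ∘ g) := by
  rcases hfg with rfl | ⟨h1, h2⟩ | ⟨s, i, π, hs, hi, hπ, rfl, rfl⟩
  · exact Or.inl rfl
  · exact Or.inr (Or.inl ⟨(transRank_comp_le_right k f).trans_lt h1,
      (transRank_comp_le_right k g).trans_lt h2⟩)
  · by_cases hk : Function.Injective (k ∘ i)
    · exact Or.inr (Or.inr ⟨s, k ∘ i, π, hs, hk, hπ, rfl, rfl⟩)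
    · exact Or.inr (Or.inl ⟨transRank_comp_lt_of_not_injective s hk,
        transRank_comp_lt_of_not_injective (π ∘ s) hk⟩)

theorem MalcevRel.comp_right (k : Fin n → Fin n) (hfg : MalcevRel n N f g) :
    MalcevRel n N (f ∘ k) (g ∘ k) := by
  rcases hfg with rfl | ⟨h1, h2⟩ | ⟨s, i, π, hs, hi, hπ, rfl, rfl⟩
  · exact Or.inl rfl
  · exact Or.inr (Or.inl ⟨(transRank_comp_le_left f k).trans_lt h1,
      (transRank_comp_le_left g k).trans_lt h2⟩)
  · by_cases hk : Function.Surjective (s ∘ k)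
    · exact Or.inr (Or.inr ⟨s ∘ k, i, π, hk, hi, hπ, rfl, rfl⟩)
    · exact Or.inr (Or.inl ⟨transRank_comp_lt_of_not_surjective i hk,
        transRank_comp_lt_of_not_surjective (i ∘ π) hk⟩)

/-- The congruence given by `MalcevRel`, for a normal subgroup of the symmetric group on `q`
points. -/
def malcevCon (n : ℕ) {q : ℕ} (N : Subgroup (Equiv.Perm (Fin q))) (hN : N.Normal) :
    Con (FullTransformationMonoid n) where
  r a b := MalcevRel n N a.unop b.unop
  iseqv := ⟨fun _ => Or.inl rfl, MalcevRel.symm, MalcevRel.trans hN⟩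
  mul' {_ x y _} h₁ h₂ := MalcevRel.trans hN (h₁.comp_left y.unop) (h₂.comp_right x.unop)

theorem malcevCon_apply {hN : N.Normal} {a b : FullTransformationMonoid n} :
    malcevCon n N hN a b ↔ MalcevRel n N a.unop b.unop := Iff.rfl

theorem malcevCon_mono {N M : Subgroup (Equiv.Perm (Fin q))} (hN : N.Normal) (hM : M.Normal)
    (h : N ≤ M) : malcevCon n N hN ≤ malcevCon n M hM := by
  rw [Con.le_def]
  rintro a b (hab | hab | ⟨s, i, π, hs, hi, hπ, hab⟩)
  · exact Or.inl hab
  · exact Or.inr (Or.inl hab)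
  · exact Or.inr (Or.inr ⟨s, i, π, hs, hi, h hπ, hab⟩)

theorem malcevCon_le_of_lt {q q' : ℕ} (hq : q < q') {N : Subgroup (Equiv.Perm (Fin q))}
    (hN : N.Normal) {M : Subgroup (Equiv.Perm (Fin q'))} (hM : M.Normal) :
    malcevCon n N hN ≤ malcevCon n M hM := by
  rw [Con.le_def]
  rintro a b (hab | ⟨h1, h2⟩ | ⟨s, i, π, hs, hi, -, h1, h2⟩)
  · exact Or.inl hab
  · exact Or.inr (Or.inl ⟨h1.trans hq, h2.trans hq⟩)
  · refine Or.inr (Or.inl ⟨?_, ?_⟩)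
    · rwa [h1, transRank_comp_eq hs hi]
    · rwa [h2, transRank_comp_eq (π.surjective.comp hs) hi]

/-- The congruence of `N` relates `i ∘ s` and `i ∘ π ∘ s` exactly when `π` is in `N`, so it
determines `N`. -/
theorem malcevRel_comp_iff (hN : N.Normal) {s : Fin n → Fin q} {i : Fin q → Fin n}
    (hs : Function.Surjective s) (hi : Function.Injective i) (π : Equiv.Perm (Fin q)) :
    MalcevRel n N (i ∘ s) (i ∘ π ∘ s) ↔ π ∈ N := by
  refine ⟨?_, fun hπ => Or.inr (Or.inr ⟨s, i, π, hs, hi, hπ, rfl, rfl⟩)⟩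
  have key : ∀ σ : Equiv.Perm (Fin q), i ∘ π ∘ s = i ∘ σ ∘ s → π = σ := fun σ h => by
    ext p
    obtain ⟨x, rfl⟩ := hs p
    exact congrArg Fin.val (hi (congrFun h x))
  rintro (h | ⟨h, -⟩ | ⟨s', i', π', hs', hi', hπ', h1, h2⟩)
  · rw [key 1 h.symm]
    exact N.one_mem
  · rw [transRank_comp_eq hs hi] at h
    exact absurd h (lt_irrefl q)
  · obtain ⟨τ, rfl, hτ⟩ := exists_perm_of_comp_eq_comp hs' hi hi' h1
    rw [key (τ * π' * τ⁻¹) ?_]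
    · exact hN.conj_mem _ hπ' τ
    · rw [h2, hτ]
      funext x
      simp

theorem exists_surjective_injective {q : ℕ} (hq : 1 ≤ q) (hqn : q ≤ n) :
    ∃ (s : Fin n → Fin q) (i : Fin q → Fin n), Function.Surjective s ∧ Function.Injective i := by
  have hi := Fin.castLE_injective hqn
  have : Nonempty (Fin q) := ⟨⟨0, hq⟩⟩
  exact ⟨Function.invFun (Fin.castLE hqn), Fin.castLE hqn, Function.invFun_surjective hi, hi⟩

theorem malcevCon_injective {N M : Subgroup (Equiv.Perm (Fin q))} (hN : N.Normal) (hM : M.Normal)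
    (hq : 1 ≤ q) (hqn : q ≤ n) (h : malcevCon n N hN = malcevCon n M hM) : N = M := by
  obtain ⟨s, i, hs, hi⟩ := exists_surjective_injective hq hqn
  ext π
  rw [← malcevRel_comp_iff hN hs hi, ← malcevRel_comp_iff hM hs hi]
  exact Con.ext_iff.1 h (op (i ∘ s)) (op (i ∘ π ∘ s))

/-- A map of rank `q` and a constant map with different image are not related at level `q`. -/
theorem not_collapses_malcevCon (hN : N.Normal) (hq : 1 ≤ q) (hqn : q ≤ n) (hn : 2 ≤ n) :
    ¬ Collapses (malcevCon n N hN) (q + 1) := by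
  intro hcol
  obtain ⟨s, i, hs, hi⟩ := exists_surjective_injective hq hqn
  have : Nontrivial (Fin n) := Fin.nontrivial_iff_two_le.2 hn
  let x : Fin n := ⟨0, by omega⟩
  obtain ⟨z, hz⟩ := exists_ne (i (s x))
  have hconst : transRank (fun _ : Fin n => z) ≤ 1 := by
    refine Finset.card_le_one.2 fun a ha b hb => ?_
    simp only [Finset.mem_image, Finset.mem_univ, true_and] at ha hb
    rw [← ha.choose_spec, ← hb.choose_spec]
  have hrel : MalcevRel n N (i ∘ s) (fun _ => z) :=
    hcol _ _ ((transRank_comp_eq hs hi).trans_lt (Nat.lt_succ_self q)) (by omega)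
  rcases hrel with h | ⟨h, -⟩ | ⟨s', i', π', hs', hi', -, h1, h2⟩
  · exact hz (congrFun h x).symm
  · rw [transRank_comp_eq hs hi] at h
    exact absurd h (lt_irrefl q)
  · obtain ⟨y, hy⟩ := (π'.surjective.comp hs') (s' x)
    have h3 := congrFun h2 y
    have h4 := congrFun h1 x
    simp only [Function.comp_apply] at hy h3 h4
    rw [hy, ← h4] at h3
    exact hz h3

theorem collapses_malcevCon (hN : N.Normal) : Collapses (malcevCon n N hN) q :=
  fun _ _ h1 h2 => Or.inr (Or.inl ⟨h1, h2⟩)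

theorem Collapses.mono {c : Con (FullTransformationMonoid n)} {q q' : ℕ} (hq : q' ≤ q)
    (hc : Collapses c q) : Collapses c q' :=
  fun f g h1 h2 => hc f g (h1.trans_le hq) (h2.trans_le hq)

theorem malcevCon_ne_of_lt {q q' : ℕ} (hq : q < q') (hq1 : 1 ≤ q) (hqn : q ≤ n) (hn : 2 ≤ n)
    {N : Subgroup (Equiv.Perm (Fin q))} (hN : N.Normal) {M : Subgroup (Equiv.Perm (Fin q'))}
    (hM : M.Normal) : malcevCon n N hN ≠ malcevCon n M hM := fun h =>
  not_collapses_malcevCon hN hq1 hqn hn (h ▸ (collapses_malcevCon hM).mono hq)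

theorem malcevCon_ne_top (hN : N.Normal) (hq : 1 ≤ q) (hqn : q ≤ n) (hn : 2 ≤ n) :
    malcevCon n N hN ≠ ⊤ := fun h =>
  not_collapses_malcevCon hN hq hqn hn (h ▸ fun _ _ _ _ => trivial)

/-- The permutations of `q` points whose action on all factorizations through `Fin q` is trivial
modulo a congruence. -/
def permSubgroup (c : Con (FullTransformationMonoid n)) (q : ℕ) :
    Subgroup (Equiv.Perm (Fin q)) where
  carrier := {π | ∀ (s : Fin n → Fin q) (i : Fin q → Fin n), MapRel c (i ∘ s) (i ∘ π ∘ s)}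
  one_mem' _ _ := MapRel.refl _
  mul_mem' {π π'} h h' s i := (h' s i).trans (h (π' ∘ s) i)
  inv_mem' {π} h s i := by
    have := (h (⇑π⁻¹ ∘ s) i).symm
    rwa [← Function.comp_assoc π, ← Equiv.Perm.coe_mul, mul_inv_cancel] at this

theorem permSubgroup_normal (c : Con (FullTransformationMonoid n)) (q : ℕ) :
    (permSubgroup c q).Normal := by
  refine ⟨fun π hπ τ s i => ?_⟩
  have := hπ (⇑τ⁻¹ ∘ s) (i ∘ τ)
  have h1 : (i ∘ τ) ∘ ⇑τ⁻¹ ∘ s = i ∘ s := by funext x; simp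
  rwa [h1] at this

theorem mem_permSubgroup_of_mapRel {c : Con (FullTransformationMonoid n)} {s : Fin n → Fin q}
    {i : Fin q → Fin n} (hs : Function.Surjective s) (hi : Function.Injective i)
    {π : Equiv.Perm (Fin q)} (h : MapRel c (i ∘ s) (i ∘ π ∘ s)) : π ∈ permSubgroup c q := by
  intro s' i'
  have hk : (fun p => Function.extend i i' id p) ∘ i = i' := funext fun p => hi.extend_apply _ _ _
  have hl : s ∘ (fun x => Function.surjInv hs (s' x)) = s' :=
    funext fun x => Function.surjInv_eq hs _
  have := (h.comp_left (Function.extend i i' id)).comp_right fun x => Function.surjInv hs (s' x)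
  change MapRel c ((_ ∘ i) ∘ (s ∘ _)) ((_ ∘ i) ∘ π ∘ (s ∘ _)) at this
  rwa [hk, hl] at this

/-- Malcev's classification: every congruence is universal or attached to a normal subgroup of the
symmetric group on `q` points for some `1 ≤ q ≤ n`. Here `q` is the largest number such that the
congruence collapses rank `q`. -/
theorem eq_top_or_exists_eq_malcevCon (hn : 1 ≤ n) (c : Con (FullTransformationMonoid n)) :
    c = ⊤ ∨ ∃ (q : ℕ) (N : Subgroup (Equiv.Perm (Fin q))) (hN : N.Normal),
      1 ≤ q ∧ q ≤ n ∧ c = malcevCon n N hN := by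
  classical
  have h1 : Collapses c 1 := fun f g hf _ => by
    have := transRank_pos f ⟨0, hn⟩
    omega
  by_cases htop : Collapses c (n + 1)
  · refine Or.inl (eq_top_iff.2 (Con.le_def.2 fun {a b} _ => ?_))
    exact htop a.unop b.unop (Nat.lt_succ_of_le (transRank_le _))
      (Nat.lt_succ_of_le (transRank_le _))
  right
  set q := Nat.findGreatest (Collapses c) n with hqdef
  have hq1 : 1 ≤ q := Nat.le_findGreatest hn h1
  have hqn : q ≤ n := Nat.findGreatest_le n
  have hq : Collapses c q := Nat.findGreatest_spec hn h1
  have hq' : ∀ m, Collapses c m → m ≤ q := fun m hm => by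
    by_contra hlt
    rcases Nat.lt_or_ge n m with h | h
    · exact htop (hm.mono h)
    · exact Nat.findGreatest_is_greatest (not_le.1 hlt) h hm
  refine ⟨q, permSubgroup c q, permSubgroup_normal c q, hq1, hqn, Con.ext fun a b => ?_⟩
  rw [malcevCon_apply]
  constructor
  · intro hab
    have hrel : MapRel c a.unop b.unop := hab
    by_cases hne : a.unop = b.unop
    · exact Or.inl hne
    by_cases hlt : transRank a.unop < q ∧ transRank b.unop < q
    · exact Or.inr (Or.inl hlt)
    by_cases hH : (∀ x y, a.unop x = a.unop y ↔ b.unop x = b.unop y) ∧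
        Set.range a.unop = Set.range b.unop
    · have hle := hq' _ (collapses_of_mapRel_of_range_eq hrel hne hH.2)
      have hr : transRank a.unop = transRank b.unop :=
        le_antisymm (transRank_le_of_ker_le fun x y => (hH.1 x y).2)
          (transRank_le_of_ker_le fun x y => (hH.1 x y).1)
      obtain ⟨s, i, hs, hi, hsi⟩ :=
        exists_eq_comp_of_transRank_eq (f := a.unop) (q := q) (by omega)
      rw [hsi] at hrel hH ⊢
      obtain ⟨π, hπ⟩ := exists_perm_of_ker_eq_of_range_eq hs hi hH.1 hH.2
      rw [hπ] at hrel ⊢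
      exact Or.inr (Or.inr ⟨s, i, π, hs, hi, mem_permSubgroup_of_mapRel hs hi hrel, rfl, rfl⟩)
    · have := hq' _ (collapses_of_mapRel hrel hH)
      have h2 := le_max_left (transRank a.unop) (transRank b.unop)
      have h3 := le_max_right (transRank a.unop) (transRank b.unop)
      exact absurd ⟨by omega, by omega⟩ hlt
  · rintro (h | ⟨h2, h3⟩ | ⟨s, i, π, -, -, hπ, h2, h3⟩)
    · rw [unop_injective h]
      exact c.refl _
    · exact hq _ _ h2 h3
    · have := hπ s i
      rw [← h2, ← h3] at this
      exact this

end Malcev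

/-! ### The congruence lattice as a chain -/

section Height

variable {n : ℕ}

/-- The labels of the non-universal congruences: a normal subgroup of a symmetric group on at least
one and at most `n` points. -/
abbrev MalcevLabel (n : ℕ) : Type :=
  Σ k : Fin n, {N : Subgroup (Equiv.Perm (Fin (k + 1))) | N.Normal}

theorem sum_ncard_normal_subgroups_perm (hn : 4 ≤ n) :
    ∑ k ∈ Finset.range n, {N : Subgroup (Equiv.Perm (Fin (k + 1))) | N.Normal}.ncard =
      3 * n - 2 := by
  induction n, hn using Nat.le_induction with
  | base =>
    simp only [Finset.sum_range_succ, Finset.sum_range_zero, zero_add]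
    rw [ncard_normal_subgroups_perm_one, ncard_normal_subgroups_perm_two,
      ncard_normal_subgroups_perm_of_ne_four (q := 3) le_rfl (by norm_num),
      ncard_normal_subgroups_perm_four]
  | succ m hm ih =>
    rw [Finset.sum_range_succ, ih, ncard_normal_subgroups_perm_of_ne_four (by omega) (by omega)]
    omega

theorem card_malcevLabel (hn : 4 ≤ n) : Nat.card (MalcevLabel n) = 3 * n - 2 := by
  rw [Nat.card_sigma, ← sum_ncard_normal_subgroups_perm hn, ← Fin.sum_univ_eq_sum_range
    (fun k => {N : Subgroup (Equiv.Perm (Fin (k + 1))) | N.Normal}.ncard)]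
  rfl

/-- The congruence with a given label, the universal congruence having the label `none`. -/
def malcevConOfLabel (n : ℕ) : Option (MalcevLabel n) → Con (FullTransformationMonoid n)
  | none => ⊤
  | some l => malcevCon n l.2.1 l.2.2

theorem malcevConOfLabel_bijective (hn : 2 ≤ n) : Function.Bijective (malcevConOfLabel n) := by
  constructor
  · rintro (_ | ⟨k, N, hN⟩) (_ | ⟨k', M, hM⟩) h
    · rfl
    · exact absurd h.symm (malcevCon_ne_top hM (by omega) (by omega) hn)
    · exact absurd h (malcevCon_ne_top hN (by omega) (by omega) hn)
    · rcases lt_trichotomy k k' with hk | rfl | hk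
      · exact absurd h (malcevCon_ne_of_lt (by simpa using hk) (by omega) (by omega) hn hN hM)
      · obtain rfl := malcevCon_injective hN hM (by omega) (by omega) h
        rfl
      · exact absurd h.symm
          (malcevCon_ne_of_lt (by simpa using hk) (by omega) (by omega) hn hM hN)
  · intro c
    rcases eq_top_or_exists_eq_malcevCon (by omega) c with rfl | ⟨q, N, hN, hq1, hqn, rfl⟩
    · exact ⟨none, rfl⟩
    · obtain ⟨k, rfl⟩ : ∃ k, q = k + 1 := ⟨q - 1, by omega⟩
      exact ⟨some ⟨⟨k, by omega⟩, N, hN⟩, rfl⟩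

theorem card_con_fullTransformationMonoid (hn : 4 ≤ n) :
    Nat.card (Con (FullTransformationMonoid n)) = 3 * n - 1 := by
  rw [← Nat.card_congr (Equiv.ofBijective _ (malcevConOfLabel_bijective (n := n) (by omega))),
    Finite.card_option, card_malcevLabel hn]
  omega

theorem con_fullTransformationMonoid_le_total (hn : 2 ≤ n)
    (c d : Con (FullTransformationMonoid n)) : c ≤ d ∨ d ≤ c := by
  obtain ⟨a, rfl⟩ := (malcevConOfLabel_bijective hn).2 c
  obtain ⟨b, rfl⟩ := (malcevConOfLabel_bijective hn).2 d
  rcases a with _ | ⟨k, N, hN⟩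
  · exact Or.inr le_top
  rcases b with _ | ⟨k', M, hM⟩
  · exact Or.inl le_top
  rcases lt_trichotomy k k' with hk | rfl | hk
  · exact Or.inl (malcevCon_le_of_lt (by simpa using hk) hN hM)
  · exact ((isChain_normal_subgroups_perm (by omega)).total hN hM).imp
      (malcevCon_mono hN hM) (malcevCon_mono hM hN)
  · exact Or.inr (malcevCon_le_of_lt (by simpa using hk) hM hN)

end Height

theorem mainTheorem11 (n : ℕ) (hn : 4 ≤ n) :
    posetHeight (Con (FullTransformationMonoid n)) = ((3 * n - 1 : ℕ) : ℕ∞) := by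
  have hchain : IsChain (fun x y => x ≤ y)
      (Set.univ : Set (Con (FullTransformationMonoid n))) :=
    fun c _ d _ _ => con_fullTransformationMonoid_le_total (by omega) c d
  have hcard := card_con_fullTransformationMonoid hn
  have : Finite (Con (FullTransformationMonoid n)) := Nat.finite_of_card_ne_zero (by omega)
  rw [posetHeight, ← Set.encard_eq_chainHeight_of_isChain _ hchain, Set.encard_univ,
    ENat.card_eq_coe_natCard, hcard]
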